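/- Setting. Let $G$ be a finite directed multigraph with vertices $v_1,\dots,v_N$ and edge set $E^1$ (loops and parallel edges allowed); the edge $e$ has initial vertex $i(e)$ and terminal vertex $t(e)$. Assume that $G$ is strongly connected (any vertex can be reached from any other one along a directed path). To each vertex $v_j$ attach a copy $X_j$ of Euclidean space $\mathbb{R}^d$ and a non-empty compact set $C_j\subset X_j$. A graph-directed iterated function system (GDIFS) $\mathcal{GD}=(f_e)_{e\in E^1}$ consists of a contraction $f_e:X_{t(e)}\to X_{i(e)}$ (with Lipschitz constant $<1$) for every edge $e$. Its inhomogeneous attractor is the list $(F_1,\dots,F_N)$ of non-empty compact sets $F_j\subset X_j$ with $$F_j=\bigcup_{e:\,i(e)=v_j} f_e(F_{t(e)})\;\cup\;C_j\qquad(1\le j\le N).$$ The system satisfies the graph-directed inhomogeneous open set condition (GDIOSC) if there are non-empty bounded open sets $U_j\subset X_j$ such that $f_e(U_{t(e)})\subset U_{i(e)}$ for every edge $e$, $f_e(U_{t(e)})\cap f_{e'}(U_{t(e')})=\emptyset$ for any two different edges $e\ne e'$ with the same initial vertex, and $C_j\subset\overline{U_j}$ for every $j$. A similarity map is a map with $|f(x)-f(y)|=r|x-y|$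 for all $x,y$ and some constant $r>0$. Theorem (continuity of dimension). Let $\mathcal{GD}_n=(f_e^n)_{e\in E^1}$, $n\in\mathbb{N}$, be GDIFSs consisting of similarity maps and let $\mathcal{GD}=(f_e)_{e\in E^1}$ be a GDIFS, all with the same graph $G$ and the same sets $C_j$, and suppose that $f_e^n\to f_e$ pointwise as $n\to\infty$ for every edge $e$, where every limit map $f_e$ is injective (for $d\ge 1$ this only says that $f_e$ is not constant). Suppose that $\mathcal{GD}$ and every $\mathcal{GD}_n$ satisfy the GDIOSC. Let $(F_1^n,\dots,F_N^n)$ and $(F_1,\dots,F_N)$ be the inhomogeneous attractors of $\mathcal{GD}_n$ and $\mathcal{GD}$. Then: 1. if $\overline{\dim}_B(C_i)=\overline{\dim}_B(C_j)$ for all $1\le i,j\le N$, then $\overline{\dim}_B(F_i^n)\to\overline{\dim}_B(F_i)$ as $n\to\infty$ for every $i$; 2. if $\dim_H(C_i)=\dim_H(C_j)$ for all $1\le i,j\le N$, then $\dim_H(F_i^n)\to\dim_H(F_i)$ as $n\to\infty$ for every $i$. Here $\overline{\dim}_B$ is the upper box dimension and $\dim_H$ the Hausdorff dimension. -/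

import Mathlib

open Filter Topology Set TopologicalSpace

/-- A directed multigraph with vertex set `V` and edge set `E`; loops and parallel edges are
allowed. `ini e` is the initial vertex of the edge `e` and `ter e` its terminal vertex. -/
structure DirGraph (V E : Type*) where
  ini : E → V
  ter : E → V

/-- Strong connectedness: any vertex can be reached from any other one by a directed path. -/
def DirGraph.StronglyConnected {V E : Type*} (G : DirGraph V E) : Prop :=
  ∀ u v : V, Relation.ReflTransGen (fun a b => ∃ e, G.ini e = a ∧ G.ter e = b) u v

/-- The space attached to each vertex: a copy of `ℝ^d` with the Euclidean metric. -/
abbrev VertexSpace (d : ℕ) : Type := EuclideanSpace ℝ (Fin d)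

/-- A graph-directed iterated function system over the graph `G` with condensation sets `C v`
(non-empty compact subsets of the vertex spaces): to each edge `e` belongs a contraction
`map e` from the space at the terminal vertex of `e` to the space at the initial vertex of `e`. -/
structure GDIFS {V E : Type*} (G : DirGraph V E) (d : ℕ)
    (C : V → NonemptyCompacts (VertexSpace d)) where
  map : E → VertexSpace d → VertexSpace d
  contracting : ∀ e, ∃ ρ : NNReal, ContractingWith ρ (map e)

namespace GDIFS

variable {V E : Type*} {G : DirGraph V E} {d : ℕ} {C : V → NonemptyCompacts (VertexSpace d)}

/-- All maps of the system are similarity maps (with positive ratio; the ratio is smaller than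
one because the maps are contractions). -/
def IsSimilarity (S : GDIFS G d C) : Prop :=
  ∀ e, ∃ r : ℝ, 0 < r ∧ ∀ x y, dist (S.map e x) (S.map e y) = r * dist x y

/-- `F` is the inhomogeneous graph-directed attractor of the system: a family of non-empty compact
sets with `F v = (⋃ f_e (F (t e)), e an edge with initial vertex v) ∪ C v`. -/
def IsAttractor (S : GDIFS G d C) (F : V → NonemptyCompacts (VertexSpace d)) : Prop :=
  ∀ v, (F v : Set (VertexSpace d)) =
    (⋃ e ∈ {e : E | G.ini e = v}, S.map e '' (F (G.ter e) : Set (VertexSpace d))) ∪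
      (C v : Set (VertexSpace d))

/-- The graph-directed inhomogeneous open set condition. Images under edges with different initial
vertices lie in different copies of `ℝ^d`, so disjointness is a condition on pairs of edges with
the same initial vertex. -/
def GDIOSC (S : GDIFS G d C) : Prop :=
  ∃ U : V → Set (VertexSpace d),
    (∀ v, IsOpen (U v) ∧ (U v).Nonempty ∧ Bornology.IsBounded (U v)) ∧
    (∀ e, S.map e '' U (G.ter e) ⊆ U (G.ini e)) ∧
    (∀ e e', e ≠ e' → G.ini e = G.ini e' →
      Disjoint (S.map e '' U (G.ter e)) (S.map e' '' U (G.ter e'))) ∧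
    (∀ v, (C v : Set (VertexSpace d)) ⊆ closure (U v))

end GDIFS

/-- The least number of sets of diameter at most `δ` that are needed to cover `A`. -/
noncomputable def coverNum {X : Type*} [PseudoEMetricSpace X] (δ : ℝ) (A : Set X) : ℕ :=
  sInf {n : ℕ | ∃ s : Fin n → Set X,
    (∀ i, Metric.ediam (s i) ≤ ENNReal.ofReal δ) ∧ A ⊆ ⋃ i, s i}

/-- The upper box dimension of a non-empty (totally) bounded set, as an extended real number. -/
noncomputable def upperBoxDim {X : Type*} [PseudoEMetricSpace X] (A : Set X) : EReal :=
  limsup (fun δ : ℝ => ((Real.log (coverNum δ A) / -Real.log δ : ℝ) : EReal)) (𝓝[>] 0)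

/-! Let `r e` be the ratio of `f e`, and let T_t be the transfer operator on vertex functions with
weights `r e ^ t`. Morally dim F_i = max(dim C, s), where s is the exponent at which T_s has
spectral radius 1, and s depends continuously on the ratios. Neither s nor a spectral radius is
constructed. A dichotomy replaces them: for each t, either T_t h < h for some h > 0, or T_t h ≥ h
for some nonzero h ≥ 0.

In the first case, if also dim C < t, then dim F ≤ t. For box dimension this is an induction over
scales (`upperBoxDim_attractor_le`); for Hausdorff dimension the Hausdorff contents satisfy c ≤ T_t
c, which forces c = 0 (`dimH_attractor_le`). In the second case a mass distribution argument, with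
volumes in the open set condition, bounds ∑ δ_i ^ t below over all finite covers
(`exists_hasCoverBound`), so both dimensions are at least t. Since F contains C, dim C is a lower
bound as well.

Pointwise convergence gives convergence of ratios. Strict subinvariance is an open condition on the
weights, and superinvariance survives perturbation after a slight decrease of t. Continuity follows
(`DirGraph.tendsto_of_dichotomy`). -/

/-- Some positive vertex function is strictly decreased by the transfer operator with edge
weights `a`. -/
def DirGraph.StrictlySubinvariant {V E : Type*} [Fintype E] [DecidableEq V] (G : DirGraph V E)
    (a : E → ℝ) : Prop :=
  ∃ h : V → ℝ, (∀ v, 0 < h v) ∧ ∀ v, ∑ e with G.ini e = v, a e * h (G.ter e) < h v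

/-- Some nonzero nonnegative vertex function is not decreased by the transfer operator with edge
weights `a`. -/
def DirGraph.Superinvariant {V E : Type*} [Fintype E] [DecidableEq V] (G : DirGraph V E)
    (a : E → ℝ) : Prop :=
  ∃ h : V → ℝ, (∀ v, 0 ≤ h v) ∧ (∃ v, 0 < h v) ∧
    ∀ v, h v ≤ ∑ e with G.ini e = v, a e * h (G.ter e)

/-! ### Perron–Frobenius dichotomy for nonnegative edge weights -/

namespace DirGraph

variable {V E : Type*} [Fintype E] [DecidableEq V] (G : DirGraph V E)

/-- The partial sums of the Neumann series of the transfer operator, applied to the constant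
function `1`. -/
def neumannSum (a : E → ℝ) : ℕ → V → ℝ
  | 0 => fun _ => 1
  | k + 1 => fun v => 1 + ∑ e with G.ini e = v, a e * neumannSum a k (G.ter e)

theorem one_le_neumannSum {a : E → ℝ} (ha : ∀ e, 0 ≤ a e) (k : ℕ) (v : V) :
    1 ≤ G.neumannSum a k v := by
  induction k generalizing v with
  | zero => exact le_rfl
  | succ k ih =>
    have : 0 ≤ ∑ e with G.ini e = v, a e * G.neumannSum a k (G.ter e) :=
      Finset.sum_nonneg fun e _ => mul_nonneg (ha e) (zero_le_one.trans (ih _))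
    simpa [neumannSum] using this

theorem monotone_neumannSum {a : E → ℝ} (ha : ∀ e, 0 ≤ a e) (v : V) :
    Monotone fun k => G.neumannSum a k v := by
  refine monotone_nat_of_le_succ fun k => ?_
  induction k generalizing v with
  | zero => exact G.one_le_neumannSum ha 1 v
  | succ k ih =>
    simp only [neumannSum] at ih ⊢
    gcongr with e _
    · exact ha e
    · exact ih _

/-- If the Neumann series converges, its sum satisfies h = 1 + T h, so T h < h. Otherwise the
partial sums x_k ≤ 1 + T x_k have total mass tending to infinity; after normalisation the 1
disappears, and a limit point y in the simplex satisfies y ≤ T y. -/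
theorem strictlySubinvariant_or_superinvariant [Fintype V] {a : E → ℝ} (ha : ∀ e, 0 ≤ a e) :
    G.StrictlySubinvariant a ∨ G.Superinvariant a := by
  by_cases hb : ∀ v, BddAbove (range fun k => G.neumannSum a k v)
  · left
    have hlim := fun v => tendsto_atTop_ciSup (G.monotone_neumannSum ha v) (hb v)
    refine ⟨fun v => ⨆ k, G.neumannSum a k v, fun v => ?_, fun v => ?_⟩
    · exact zero_lt_one.trans_le (le_ciSup (hb v) 0)
    · have h1 : Tendsto (fun k => G.neumannSum a (k + 1) v) atTop
          (𝓝 (1 + ∑ e with G.ini e = v, a e * ⨆ k, G.neumannSum a k (G.ter e))) :=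
        tendsto_const_nhds.add (tendsto_finsetSum _ fun e _ => (hlim (G.ter e)).const_mul _)
      have h2 := tendsto_nhds_unique h1 ((tendsto_add_atTop_iff_nat 1).2 (hlim v))
      simp only [] at h2 ⊢
      linarith
  · right
    push Not at hb
    obtain ⟨v₀, hv₀⟩ := hb
    set S : ℕ → ℝ := fun k => ∑ v, G.neumannSum a k v with hS
    have hx0 : ∀ k v, 0 ≤ G.neumannSum a k v :=
      fun k v => zero_le_one.trans (G.one_le_neumannSum ha k v)
    have hle : ∀ k v, G.neumannSum a k v ≤ S k := fun k v =>
      Finset.single_le_sum (f := fun v => G.neumannSum a k v) (fun i _ => hx0 k i)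
        (Finset.mem_univ v)
    have hS1 : ∀ k, 1 ≤ S k := fun k => (G.one_le_neumannSum ha k v₀).trans (hle k v₀)
    have hSpos : ∀ k, 0 < S k := fun k => zero_lt_one.trans_le (hS1 k)
    have hStop : Tendsto S atTop atTop :=
      tendsto_atTop_mono (fun k => hle k v₀)
        ((tendsto_atTop_of_monotone (G.monotone_neumannSum ha v₀)).resolve_right
          fun ⟨l, hl⟩ => hv₀ hl.bddAbove_range)
    obtain ⟨y, hy, φ, hφ, hlim⟩ := (isCompact_stdSimplex ℝ V).tendsto_subseq
      (x := fun k v => G.neumannSum a k v / S k) (fun k =>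
        ⟨fun v => div_nonneg (hx0 k v) (hSpos k).le, by
          rw [← Finset.sum_div]; exact div_self (hSpos k).ne'⟩)
    rw [tendsto_pi_nhds] at hlim
    refine ⟨y, hy.1, ?_, fun v => ?_⟩
    · by_contra! hcon
      have : ∑ v, y v ≤ 0 := Finset.sum_nonpos fun v _ => hcon v
      linarith [hy.2]
    · have h1 : Tendsto (fun k => G.neumannSum a (φ k) v / S (φ k) - (S (φ k))⁻¹) atTop
          (𝓝 (y v - 0)) :=
        (hlim v).sub (tendsto_inv_atTop_zero.comp (hStop.comp hφ.tendsto_atTop))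
      rw [sub_zero] at h1
      refine le_of_tendsto_of_tendsto' h1
        (tendsto_finsetSum _ fun e _ => (hlim (G.ter e)).const_mul (a e)) fun k => ?_
      have h3 : G.neumannSum a (φ k) v ≤ G.neumannSum a (φ k + 1) v :=
        G.monotone_neumannSum ha v (Nat.le_succ _)
      rw [neumannSum] at h3
      have h4 : ∑ e with G.ini e = v, a e * (G.neumannSum a (φ k) (G.ter e) / S (φ k)) =
          (∑ e with G.ini e = v, a e * G.neumannSum a (φ k) (G.ter e)) / S (φ k) := by
        rw [Finset.sum_div]
        exact Finset.sum_congr rfl fun e _ => by ring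
      simp only [Function.comp_apply]
      rw [h4, inv_eq_one_div, ← sub_div]
      exact div_le_div_of_nonneg_right (by linarith) (hSpos _).le

variable {G}

theorem StrictlySubinvariant.eventually [Finite V] {ι : Type*} {l : Filter ι} {a : E → ℝ}
    {b : ι → E → ℝ} (h : G.StrictlySubinvariant a)
    (hb : ∀ e, Tendsto (fun n => b n e) l (𝓝 (a e))) :
    ∀ᶠ n in l, G.StrictlySubinvariant (b n) := by
  obtain ⟨x, hx0, hx⟩ := h
  have : ∀ᶠ n in l, ∀ v, ∑ e with G.ini e = v, b n e * x (G.ter e) < x v :=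
    eventually_all.2 fun v =>
      (tendsto_finsetSum _ fun e _ => (hb e).mul_const (x (G.ter e))).eventually_lt_const (hx v)
  exact this.mono fun n hn => ⟨x, hx0, hn⟩

theorem Superinvariant.mono {a b : E → ℝ} (h : G.Superinvariant a) (hab : ∀ e, a e ≤ b e) :
    G.Superinvariant b := by
  obtain ⟨x, hx0, hx1, hx⟩ := h
  exact ⟨x, hx0, hx1, fun v => (hx v).trans <| Finset.sum_le_sum fun e _ =>
    mul_le_mul_of_nonneg_right (hab e) (hx0 _)⟩

/-- Multiplying the weights of all edges leaving v by x v / (T x) v ≤ 1 turns the inequality into an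
equality, as needed for distributing mass consistently. -/
theorem Superinvariant.exists_invariant_weights {a : E → ℝ} (h : G.Superinvariant a)
    (ha : ∀ e, 0 ≤ a e) :
    ∃ (w : E → ℝ) (x : V → ℝ), (∀ e, 0 ≤ w e) ∧ (∀ e, w e ≤ a e) ∧ (∀ v, 0 ≤ x v) ∧
      (∃ v, 0 < x v) ∧ ∀ v, ∑ e with G.ini e = v, w e * x (G.ter e) = x v := by
  obtain ⟨x, hx0, hx1, hx⟩ := h
  set T : V → ℝ := fun v => ∑ e with G.ini e = v, a e * x (G.ter e) with hT
  have hT0 : ∀ v, 0 ≤ T v := fun v => (hx0 v).trans (hx v)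
  refine ⟨fun e => a e * (x (G.ini e) / T (G.ini e)), x,
    fun e => mul_nonneg (ha e) (div_nonneg (hx0 _) (hT0 _)),
    fun e => mul_le_of_le_one_right (ha e) (div_le_one_of_le₀ (hx _) (hT0 _)),
    hx0, hx1, fun v => ?_⟩
  have h1 : ∑ e with G.ini e = v, a e * (x (G.ini e) / T (G.ini e)) * x (G.ter e) =
      x v / T v * T v := by
    rw [hT, Finset.mul_sum]
    refine Finset.sum_congr rfl fun e he => ?_
    rw [(Finset.mem_filter.1 he).2]
    ring
  rw [h1]
  -- Where `T v = 0`, also `x v = 0`, so division by zero does no harm.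
  refine div_mul_cancel_of_imp fun h0 => le_antisymm ((hx v).trans h0.le) (hx0 v)

end DirGraph

/-! ### Covering numbers and upper box dimension -/

section CoverNum

variable {X : Type*} [PseudoMetricSpace X]

theorem coverNum_le_card {ι : Type*} [Fintype ι] {δ : ℝ} {A : Set X} (s : ι → Set X)
    (hs : ∀ i, Metric.ediam (s i) ≤ ENNReal.ofReal δ) (hA : A ⊆ ⋃ i, s i) :
    coverNum δ A ≤ Fintype.card ι := by
  refine Nat.sInf_le ⟨s ∘ (Fintype.equivFin ι).symm, fun i => hs _, hA.trans ?_⟩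
  exact iUnion_subset fun i => subset_iUnion_of_subset (Fintype.equivFin ι i) (by simp)

/-- Compactness makes the set of admissible cardinalities non-empty, so its `sInf` is attained and
is not the default value 0. -/
theorem IsCompact.exists_coverNum_cover {A : Set X} (hA : IsCompact A) {δ : ℝ} (hδ : 0 < δ) :
    ∃ s : Fin (coverNum δ A) → Set X,
      (∀ i, Metric.ediam (s i) ≤ ENNReal.ofReal δ) ∧ A ⊆ ⋃ i, s i := by
  refine Nat.sInf_mem (s := {n : ℕ | ∃ s : Fin n → Set X,
    (∀ i, Metric.ediam (s i) ≤ ENNReal.ofReal δ) ∧ A ⊆ ⋃ i, s i}) ?_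
  obtain ⟨t, -, htf, ht⟩ := hA.finite_cover_balls (half_pos hδ)
  have := htf.fintype
  refine ⟨Fintype.card t, fun i => Metric.ball ((Fintype.equivFin t).symm i : X) (δ / 2),
    fun i => ?_, ht.trans ?_⟩
  · simp only [← Metric.eball_ofReal]
    refine Metric.ediam_eball_le.trans_eq ?_
    rw [← ENNReal.ofReal_ofNat 2, ← ENNReal.ofReal_mul zero_le_two, mul_div_cancel₀ _ two_ne_zero]
  · exact iUnion₂_subset fun x hx => subset_iUnion_of_subset (Fintype.equivFin t ⟨x, hx⟩) (by simp)

theorem IsCompact.coverNum_mono {A B : Set X} (hB : IsCompact B) (hAB : A ⊆ B) {δ : ℝ}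
    (hδ : 0 < δ) : coverNum δ A ≤ coverNum δ B := by
  obtain ⟨s, hs, hc⟩ := hB.exists_coverNum_cover hδ
  simpa using coverNum_le_card s hs (hAB.trans hc)

theorem IsCompact.coverNum_anti {A : Set X} (hA : IsCompact A) {δ δ' : ℝ} (hδ : 0 < δ)
    (h : δ ≤ δ') : coverNum δ' A ≤ coverNum δ A := by
  obtain ⟨s, hs, hc⟩ := hA.exists_coverNum_cover hδ
  simpa using coverNum_le_card s (fun i => (hs i).trans (ENNReal.ofReal_le_ofReal h)) hc

theorem upperBoxDim_nonneg (A : Set X) : 0 ≤ upperBoxDim A := by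
  refine le_limsup_of_frequently_le (Eventually.frequently ?_)
  filter_upwards [Ioo_mem_nhdsGT (zero_lt_one' ℝ)] with δ hδ
  exact EReal.coe_nonneg.2 (div_nonneg (Real.log_natCast_nonneg _)
    (neg_nonneg.2 (Real.log_nonpos hδ.1.le hδ.2.le)))

theorem IsCompact.upperBoxDim_mono {A B : Set X} (hB : IsCompact B) (hAB : A ⊆ B) :
    upperBoxDim A ≤ upperBoxDim B := by
  refine limsup_le_limsup ?_
  filter_upwards [Ioo_mem_nhdsGT (zero_lt_one' ℝ)] with δ hδ
  refine EReal.coe_le_coe_iff.2 (div_le_div_of_nonneg_right ?_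
    (neg_nonneg.2 (Real.log_nonpos hδ.1.le hδ.2.le)))
  rcases Nat.eq_zero_or_pos (coverNum δ A) with h | h
  · rw [h, Nat.cast_zero, Real.log_zero]
    exact Real.log_natCast_nonneg _
  · exact Real.log_le_log (by exact_mod_cast h) (by exact_mod_cast hB.coverNum_mono hAB hδ.1)

theorem tendsto_add_div_neg_log (c t : ℝ) :
    Tendsto (fun δ : ℝ => ((t + c / -Real.log δ : ℝ) : EReal)) (𝓝[>] 0) (𝓝 (t : EReal)) := by
  refine (continuous_coe_real_ereal.tendsto t).comp ?_
  have h1 : Tendsto (fun δ : ℝ => -Real.log δ) (𝓝[>] 0) atTop :=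
    tendsto_neg_atBot_atTop.comp Real.tendsto_log_nhdsGT_zero
  simpa using (tendsto_const_nhds (x := t)).add (h1.const_div_atTop c)

theorem upperBoxDim_le_of_coverNum_le {A : Set X} {M t : ℝ} (hM : 0 < M) (ht : 0 ≤ t)
    (h : ∀ δ : ℝ, 0 < δ → δ ≤ 1 → (coverNum δ A : ℝ) ≤ M * δ ^ (-t)) :
    upperBoxDim A ≤ t := by
  -- The maximum with 0 serves the case `coverNum δ A = 0`, where `Real.log 0 = 0`.
  rw [← (tendsto_add_div_neg_log (max (Real.log M) 0) t).limsup_eq]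
  refine limsup_le_limsup ?_
  filter_upwards [Ioo_mem_nhdsGT (zero_lt_one' ℝ)] with δ hδ
  have hl : 0 < -Real.log δ := neg_pos.2 (Real.log_neg hδ.1 hδ.2)
  refine EReal.coe_le_coe_iff.2 ?_
  rw [div_le_iff₀ hl, add_mul, div_mul_cancel₀ _ hl.ne']
  rcases Nat.eq_zero_or_pos (coverNum δ A) with h0 | h0
  · rw [h0, Nat.cast_zero, Real.log_zero]
    have := le_max_right (Real.log M) 0
    positivity
  · have h1 := Real.log_le_log (by exact_mod_cast h0) (h δ hδ.1 hδ.2.le)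
    rw [Real.log_mul hM.ne' (Real.rpow_pos_of_pos hδ.1 _).ne', Real.log_rpow hδ.1] at h1
    have := le_max_left (Real.log M) 0
    linarith

theorem le_upperBoxDim_of_le_coverNum {A : Set X} {c t : ℝ} (hc : 0 < c)
    (h : ∀ δ : ℝ, 0 < δ → δ ≤ 1 → c * δ ^ (-t) ≤ (coverNum δ A : ℝ)) :
    (t : EReal) ≤ upperBoxDim A := by
  rw [← (tendsto_add_div_neg_log (Real.log c) t).limsup_eq]
  refine limsup_le_limsup ?_
  filter_upwards [Ioo_mem_nhdsGT (zero_lt_one' ℝ)] with δ hδ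
  have hl : 0 < -Real.log δ := neg_pos.2 (Real.log_neg hδ.1 hδ.2)
  refine EReal.coe_le_coe_iff.2 ?_
  rw [le_div_iff₀ hl, add_mul, div_mul_cancel₀ _ hl.ne']
  have hp := Real.rpow_pos_of_pos hδ.1 (-t)
  have h1 := Real.log_le_log (mul_pos hc hp) (h δ hδ.1 hδ.2.le)
  rw [Real.log_mul hc.ne' hp.ne', Real.log_rpow hδ.1] at h1
  linarith

/-- The limsup controls small δ only; on the remaining scales up to `R` the count is bounded and δ ^
(-t) is bounded below. Scales above 1 matter because the recursion passes from δ to δ / r e. -/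
theorem IsCompact.exists_coverNum_le_of_upperBoxDim_lt {A : Set X} (hA : IsCompact A) {t : ℝ}
    (ht : 0 ≤ t) (h : upperBoxDim A < t) (R : ℝ) :
    ∃ K : ℝ, ∀ δ : ℝ, 0 < δ → δ ≤ R → (coverNum δ A : ℝ) ≤ K * δ ^ (-t) := by
  have h1 := eventually_lt_of_limsup_lt h
  obtain ⟨δ₀, hδ₀, hsub⟩ := mem_nhdsGT_iff_exists_Ioo_subset.1
    (h1.and (Ioo_mem_nhdsGT (zero_lt_one' ℝ)))
  have hδ₀ : 0 < δ₀ := hδ₀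
  have hsmall : ∀ δ : ℝ, 0 < δ → δ < δ₀ → (coverNum δ A : ℝ) ≤ δ ^ (-t) := by
    intro δ h0 h1
    obtain ⟨h2, h3⟩ := hsub ⟨h0, h1⟩
    have hl : 0 < -Real.log δ := neg_pos.2 (Real.log_neg h3.1 h3.2)
    rw [EReal.coe_lt_coe_iff, div_lt_iff₀ hl] at h2
    rcases Nat.eq_zero_or_pos (coverNum δ A) with h4 | h4
    · rw [h4, Nat.cast_zero]
      positivity
    · rw [← Real.log_le_log_iff (by exact_mod_cast h4) (by positivity), Real.log_rpow h0]
      linarith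
  set N : ℝ := (coverNum (δ₀ / 2) A : ℝ) with hN
  refine ⟨max 1 (N * max R 1 ^ t), fun δ h0 hR => ?_⟩
  have hp : 0 < δ ^ (-t) := Real.rpow_pos_of_pos h0 _
  rcases lt_or_ge δ δ₀ with h1 | h1
  · exact (hsmall δ h0 h1).trans (le_mul_of_one_le_left hp.le (le_max_left _ _))
  · have hle : (coverNum δ A : ℝ) ≤ N :=
      Nat.cast_le.2 (hA.coverNum_anti (half_pos hδ₀) (by linarith))
    have hN0 : 0 ≤ N := Nat.cast_nonneg _
    have h2 : 1 ≤ max R 1 ^ t * δ ^ (-t) := by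
      rw [Real.rpow_neg h0.le, ← div_eq_mul_inv, one_le_div (Real.rpow_pos_of_pos h0 _)]
      exact Real.rpow_le_rpow h0.le (hR.trans (le_max_left _ _)) ht
    calc (coverNum δ A : ℝ) ≤ N * 1 := by linarith
      _ ≤ N * (max R 1 ^ t * δ ^ (-t)) := by gcongr
      _ = (N * max R 1 ^ t) * δ ^ (-t) := by ring
      _ ≤ _ := by gcongr; exact le_max_right _ _

end CoverNum

section Similarity

variable {X Y : Type*} [PseudoMetricSpace X] [PseudoMetricSpace Y] {f : X → Y} {r : ℝ}

theorem lipschitzWith_of_dist_eq (hr : 0 < r) (hf : ∀ x y, dist (f x) (f y) = r * dist x y) :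
    LipschitzWith r.toNNReal f :=
  LipschitzWith.of_dist_le_mul fun x y => by rw [hf, Real.coe_toNNReal _ hr.le]

theorem antilipschitzWith_of_dist_eq (hr : 0 < r) (hf : ∀ x y, dist (f x) (f y) = r * dist x y) :
    AntilipschitzWith (r⁻¹).toNNReal f :=
  AntilipschitzWith.of_le_mul_dist fun x y => by
    rw [hf, Real.coe_toNNReal _ (inv_nonneg.2 hr.le), inv_mul_cancel_left₀ hr.ne']

end Similarity

/-! ### Upper bound for the box dimension -/

section Attractor

variable {V E X : Type*} [Fintype E] [DecidableEq V] [PseudoMetricSpace X]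
  {G : DirGraph V E} {f : E → X → X} {r : E → ℝ} {C F : V → Set X}

theorem coverNum_attractor_le (hr : ∀ e, 0 < r e)
    (hf : ∀ e x y, dist (f e x) (f e y) = r e * dist x y)
    (hC : ∀ v, IsCompact (C v)) (hF : ∀ v, IsCompact (F v))
    (hsub : ∀ v, F v ⊆ (⋃ e ∈ {e : E | G.ini e = v}, f e '' F (G.ter e)) ∪ C v)
    {δ : ℝ} (hδ : 0 < δ) (v : V) :
    coverNum δ (F v) ≤
      ∑ e with G.ini e = v, coverNum (δ / r e) (F (G.ter e)) + coverNum δ (C v) := by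
  choose s hs hsc using fun e : Finset.univ.filter (fun e => G.ini e = v) =>
    (hF (G.ter e)).exists_coverNum_cover (div_pos hδ (hr e))
  obtain ⟨u, hu, huc⟩ := (hC v).exists_coverNum_cover hδ
  have key := coverNum_le_card (δ := δ) (A := F v)
    (ι := (Σ e : Finset.univ.filter (fun e => G.ini e = v),
      Fin (coverNum (δ / r e) (F (G.ter e)))) ⊕ Fin (coverNum δ (C v)))
    (Sum.elim (fun p => f p.1 '' s p.1 p.2) u) ?_ ?_
  · simp only [Fintype.card_sum, Fintype.card_sigma, Fintype.card_fin] at key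
    rwa [Finset.sum_coe_sort (Finset.univ.filter (fun e => G.ini e = v))
      (fun e => coverNum (δ / r e) (F (G.ter e)))] at key
  · rintro (⟨e, i⟩ | i)
    · refine ((lipschitzWith_of_dist_eq (hr e) (hf e)).ediam_image_le _).trans ?_
      calc _ ≤ ENNReal.ofReal (r e) * ENNReal.ofReal (δ / r e) := by gcongr; exacts [le_rfl, hs e i]
        _ = ENNReal.ofReal δ := by
          rw [← ENNReal.ofReal_mul (hr e).le, mul_div_cancel₀ _ (hr e).ne']
    · exact hu i
  · intro x hx
    rcases hsub v hx with hx | hx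
    · simp only [mem_iUnion] at hx
      obtain ⟨e, he, y, hy, rfl⟩ := hx
      have he' : e ∈ Finset.univ.filter (fun e => G.ini e = v) := by simpa using he
      obtain ⟨i, hi⟩ := mem_iUnion.1 (hsc ⟨e, he'⟩ hy)
      exact mem_iUnion.2 ⟨Sum.inl ⟨⟨e, he'⟩, i⟩, mem_image_of_mem _ hi⟩
    · obtain ⟨i, hi⟩ := mem_iUnion.1 (huc hx)
      exact mem_iUnion.2 ⟨Sum.inr i, hi⟩

theorem exists_ratio_bounds (hr : ∀ e, 0 < r e) (hr1 : ∀ e, r e < 1) :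
    ∃ a b : ℝ, 0 < a ∧ a < 1 ∧ 0 < b ∧ b < 1 ∧ ∀ e, a ≤ r e ∧ r e ≤ b := by
  have h1 : ∀ᶠ a in 𝓝[>] (0 : ℝ), ∀ e, a ≤ r e :=
    eventually_all.2 fun e => mem_of_superset (Ioo_mem_nhdsGT (hr e)) fun _ h => h.2.le
  have h2 : ∀ᶠ b in 𝓝[<] (1 : ℝ), ∀ e, r e ≤ b :=
    eventually_all.2 fun e => mem_of_superset (Ioo_mem_nhdsLT (hr1 e)) fun _ h => h.1.le
  obtain ⟨a, ha, ha'⟩ := (h1.and (Ioo_mem_nhdsGT (zero_lt_one' ℝ))).exists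
  obtain ⟨b, hb, hb'⟩ := (h2.and (Ioo_mem_nhdsLT (zero_lt_one' ℝ))).exists
  exact ⟨a, b, ha'.1, ha'.2, hb'.1, hb'.2, fun e => ⟨ha e, hb e⟩⟩

/-- The ansatz N(δ, F v) ≤ M h(v) δ ^ (-t) reproduces itself under the covering recursion: the
strict gap h - T h leaves room for the covers of C v once M is large. -/
theorem upperBoxDim_attractor_le [Finite V] (hr : ∀ e, 0 < r e) (hr1 : ∀ e, r e < 1)
    (hf : ∀ e x y, dist (f e x) (f e y) = r e * dist x y)
    (hC : ∀ v, IsCompact (C v)) (hF : ∀ v, IsCompact (F v))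
    (hsub : ∀ v, F v ⊆ (⋃ e ∈ {e : E | G.ini e = v}, f e '' F (G.ter e)) ∪ C v)
    {t : ℝ} (ht : 0 ≤ t) (hG : G.StrictlySubinvariant fun e => r e ^ t)
    (hCt : ∀ v, upperBoxDim (C v) < t) (v : V) : upperBoxDim (F v) ≤ t := by
  have := Fintype.ofFinite V
  obtain ⟨a, b, ha, ha1, hb, hb1, hab⟩ := exists_ratio_bounds hr hr1
  obtain ⟨h, h0, hsum⟩ := hG
  choose K hK using fun v => (hC v).exists_coverNum_le_of_upperBoxDim_lt ht (hCt v) a⁻¹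
  have hlarge : ∀ᶠ M : ℝ in atTop, 0 < M ∧ ∀ v,
      K v ≤ M * (h v - ∑ e with G.ini e = v, r e ^ t * h (G.ter e)) ∧
      (coverNum 1 (F v) : ℝ) * a⁻¹ ^ t ≤ M * h v := by
    refine (eventually_gt_atTop 0).and (eventually_all.2 fun v => ?_)
    exact ((tendsto_id.atTop_mul_const (sub_pos.2 (hsum v))).eventually_ge_atTop _).and
      ((tendsto_id.atTop_mul_const (h0 v)).eventually_ge_atTop _)
  obtain ⟨M, hM0, hM⟩ := hlarge.exists
  -- For b ^ (k + 1) ≤ δ < 1 the rescaled δ / r e lies in [b ^ k, a⁻¹], which explains both ends of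
  -- the range.
  have key : ∀ k : ℕ, ∀ v, ∀ δ : ℝ, b ^ k ≤ δ → δ ≤ a⁻¹ →
      (coverNum δ (F v) : ℝ) ≤ M * h v * δ ^ (-t) := by
    intro k
    induction k with
    | zero =>
      intro v δ h1 h2
      rw [pow_zero] at h1
      have hδ : 0 < δ := zero_lt_one.trans_le h1
      rw [Real.rpow_neg hδ.le, ← div_eq_mul_inv, le_div_iff₀ (Real.rpow_pos_of_pos hδ _)]
      refine le_trans ?_ (hM v).2
      gcongr
      exact (hF v).coverNum_anti one_pos h1
    | succ k ih =>
      intro v δ h1 h2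
      rcases le_or_gt (b ^ k) δ with h3 | h3
      · exact ih v δ h3 h2
      have hδ : 0 < δ := (pow_pos hb _).trans_le h1
      have hδ1 : δ < 1 := h3.trans_le (pow_le_one₀ hb.le hb1.le)
      have hstep : ∀ e, (coverNum (δ / r e) (F (G.ter e)) : ℝ) ≤
          M * δ ^ (-t) * (r e ^ t * h (G.ter e)) := by
        intro e
        refine (ih (G.ter e) (δ / r e) ?_ ?_).trans_eq ?_
        · rw [le_div_iff₀ (hr e)]
          calc b ^ k * r e ≤ b ^ k * b := by gcongr; exact (hab e).2
            _ ≤ δ := by rwa [← pow_succ]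
        · rw [div_le_iff₀ (hr e), inv_mul_eq_div, le_div_iff₀ ha]
          nlinarith [(hab e).1]
        · rw [Real.div_rpow hδ.le (hr e).le, Real.rpow_neg (hr e).le, div_inv_eq_mul]
          ring
      have h4 : (coverNum δ (F v) : ℝ) ≤
          ∑ e with G.ini e = v, (coverNum (δ / r e) (F (G.ter e)) : ℝ) + coverNum δ (C v) := by
        exact_mod_cast coverNum_attractor_le hr hf hC hF hsub hδ v
      have hp : 0 < δ ^ (-t) := Real.rpow_pos_of_pos hδ _
      calc (coverNum δ (F v) : ℝ)
          ≤ ∑ e with G.ini e = v, M * δ ^ (-t) * (r e ^ t * h (G.ter e)) + K v * δ ^ (-t) :=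
            h4.trans (add_le_add (Finset.sum_le_sum fun e _ => hstep e) (hK v δ hδ h2))
        _ ≤ ∑ e with G.ini e = v, M * δ ^ (-t) * (r e ^ t * h (G.ter e)) +
            M * (h v - ∑ e with G.ini e = v, r e ^ t * h (G.ter e)) * δ ^ (-t) := by
            gcongr
            exact (hM v).1
        _ = M * h v * δ ^ (-t) := by rw [← Finset.mul_sum]; ring
  refine upperBoxDim_le_of_coverNum_le (mul_pos hM0 (h0 v)) ht fun δ hδ hδ1 => ?_
  obtain ⟨k, hk⟩ := exists_pow_lt_of_lt_one hδ hb1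
  exact key k v δ hk.le (hδ1.trans (one_le_inv_iff₀.2 ⟨ha, ha1.le⟩))

end Attractor

/-! ### Hausdorff content: finite on bounded sets, with the same null sets as Hausdorff measure -/

section Content

variable {X : Type*} [PseudoEMetricSpace X]

/-- The `t`-dimensional Hausdorff content. -/
noncomputable def hausdorffContent (X : Type*) [PseudoEMetricSpace X] {t : ℝ} (ht : 0 < t) :
    MeasureTheory.OuterMeasure X :=
  MeasureTheory.OuterMeasure.ofFunction (fun s => Metric.ediam s ^ t) (by simp [ht])

theorem hausdorffContent_apply {t : ℝ} (ht : 0 < t) (A : Set X) :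
    hausdorffContent X ht A =
      ⨅ s : ℕ → Set X, ⨅ _ : A ⊆ iUnion s, ∑' n, Metric.ediam (s n) ^ t :=
  MeasureTheory.OuterMeasure.ofFunction_apply _ _ _

theorem hausdorffContent_le {t : ℝ} (ht : 0 < t) {A : Set X} {s : ℕ → Set X}
    (h : A ⊆ iUnion s) : hausdorffContent X ht A ≤ ∑' n, Metric.ediam (s n) ^ t := by
  rw [hausdorffContent_apply]
  exact iInf₂_le s h

theorem hausdorffContent_le_ediam {t : ℝ} (ht : 0 < t) (A : Set X) :
    hausdorffContent X ht A ≤ Metric.ediam A ^ t :=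
  MeasureTheory.OuterMeasure.ofFunction_le _

theorem LipschitzWith.hausdorffContent_image_le {Y : Type*} [PseudoEMetricSpace Y] {f : X → Y}
    {K : NNReal} (hf : LipschitzWith K f) (hK0 : K ≠ 0) {t : ℝ} (ht : 0 < t) (A : Set X) :
    hausdorffContent Y ht (f '' A) ≤ (K : ENNReal) ^ t * hausdorffContent X ht A := by
  have hK : (K : ENNReal) ^ t ≠ ⊤ := ENNReal.rpow_ne_top_of_nonneg ht.le ENNReal.coe_ne_top
  have hK' : (K : ENNReal) ^ t ≠ 0 :=
    (ENNReal.rpow_pos (ENNReal.coe_pos.2 (pos_iff_ne_zero.2 hK0)) ENNReal.coe_ne_top).ne'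
  rw [hausdorffContent_apply ht A, ENNReal.mul_iInf_of_ne hK' hK]
  refine le_iInf fun s => ?_
  rw [ENNReal.mul_iInf_of_ne hK' hK]
  refine le_iInf fun hs => ?_
  refine (hausdorffContent_le ht (s := fun n => f '' s n) ?_).trans ?_
  · rw [← image_iUnion]
    exact image_mono hs
  · rw [← ENNReal.tsum_mul_left]
    refine ENNReal.tsum_le_tsum fun n => ?_
    rw [← ENNReal.mul_rpow_of_nonneg _ _ ht.le]
    exact ENNReal.rpow_le_rpow (hf.ediam_image_le _) ht.le

end Content

theorem hausdorffContent_le_hausdorffMeasure {X : Type*} [EMetricSpace X] [MeasurableSpace X]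
    [BorelSpace X] {t : ℝ} (ht : 0 < t) (A : Set X) :
    hausdorffContent X ht A ≤ MeasureTheory.Measure.hausdorffMeasure t A := by
  rw [MeasureTheory.Measure.hausdorffMeasure_apply]
  refine le_iSup₂_of_le 1 one_pos (le_iInf₂ fun s hs => le_iInf fun _ => ?_)
  refine (hausdorffContent_le ht hs).trans (ENNReal.tsum_le_tsum fun n => ?_)
  rcases (s n).eq_empty_or_nonempty with h | h
  · simp [h, ht]
  · simp [h]

/-- A cover with ∑ diam ^ t < ε has all diameters at most ε ^ (1 / t), so the mesh tends to 0 by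
itself. -/
theorem hausdorffMeasure_eq_zero_of_hausdorffContent_eq_zero {X : Type*} [EMetricSpace X]
    [MeasurableSpace X] [BorelSpace X] {t : ℝ} (ht : 0 < t) {A : Set X}
    (h : hausdorffContent X ht A = 0) : MeasureTheory.Measure.hausdorffMeasure t A = 0 := by
  have hex : ∀ n : ℕ, ∃ s : ℕ → Set X, A ⊆ ⋃ i, s i ∧
      ∑' i, Metric.ediam (s i) ^ t < ((n : ENNReal) + 1)⁻¹ := by
    intro n
    have : hausdorffContent X ht A < ((n : ENNReal) + 1)⁻¹ := by
      rw [h]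
      exact ENNReal.inv_pos.2 (by finiteness)
    rw [hausdorffContent_apply] at this
    simpa only [iInf_lt_iff, exists_prop] using this
  choose s hs hsum using hex
  have hlim : Tendsto (fun n : ℕ => ((n : ENNReal) + 1)⁻¹) atTop (𝓝 0) := by
    have := (tendsto_add_atTop_iff_nat 1).2 ENNReal.tendsto_inv_nat_nhds_zero
    simpa using this
  have hrad : Tendsto (fun n : ℕ => (((n : ENNReal) + 1)⁻¹) ^ t⁻¹) atTop (𝓝 0) := by
    have := ((ENNReal.continuous_rpow_const (y := t⁻¹)).tendsto 0).comp hlim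
    rwa [ENNReal.zero_rpow_of_pos (inv_pos.2 ht)] at this
  refine le_antisymm ?_ zero_le
  refine (MeasureTheory.Measure.hausdorffMeasure_le_liminf_tsum t A _ hrad s
    (Eventually.of_forall fun n i => ?_) (Eventually.of_forall hs)).trans ?_
  · rw [ENNReal.le_rpow_inv_iff ht]
    exact (ENNReal.le_tsum i).trans (hsum n).le
  · rw [← hlim.liminf_eq]
    exact liminf_le_liminf (Eventually.of_forall fun n => (hsum n).le)

/-! ### Upper bound for the Hausdorff dimension -/

section Attractor

variable {V E X : Type*} [Fintype E] [DecidableEq V] [MetricSpace X]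
  {G : DirGraph V E} {f : E → X → X} {r : E → ℝ} {C F : V → Set X}

/-- The condensation sets have zero t-content, so the finite contents satisfy c ≤ T c. At a vertex
maximising c / h, a positive maximum l would give l h ≤ l T h < l h; hence c = 0. -/
theorem dimH_attractor_le [Finite V] (hr : ∀ e, 0 < r e)
    (hf : ∀ e x y, dist (f e x) (f e y) = r e * dist x y)
    (hF : ∀ v, Bornology.IsBounded (F v))
    (hsub : ∀ v, F v ⊆ (⋃ e ∈ {e : E | G.ini e = v}, f e '' F (G.ter e)) ∪ C v)
    {t : ℝ} (ht : 0 < t) (hG : G.StrictlySubinvariant fun e => r e ^ t)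
    (hCt : ∀ v, dimH (C v) < ENNReal.ofReal t) (v : V) : dimH (F v) ≤ ENNReal.ofReal t := by
  borelize X
  have htc : ((t.toNNReal : NNReal) : ℝ) = t := Real.coe_toNNReal _ ht.le
  set c : V → ENNReal := fun v => hausdorffContent X ht (F v) with hc
  have hfin : ∀ v, c v ≠ ⊤ := fun v =>
    ((hausdorffContent_le_ediam ht _).trans_lt
      (ENNReal.rpow_lt_top_of_nonneg ht.le (hF v).ediam_ne_top)).ne
  have hC0 : ∀ v, hausdorffContent X ht (C v) = 0 := by
    intro v
    refine le_antisymm ((hausdorffContent_le_hausdorffMeasure ht _).trans ?_) zero_le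
    have := hausdorffMeasure_of_dimH_lt (d := t.toNNReal) (hCt v)
    rw [htc] at this
    exact this.le
  have hstep : ∀ v, c v ≤ ∑ e with G.ini e = v, ENNReal.ofReal (r e ^ t) * c (G.ter e) := by
    intro v
    have hsub' : F v ⊆ (⋃ e ∈ Finset.univ.filter (fun e => G.ini e = v),
        f e '' F (G.ter e)) ∪ C v := by simpa using hsub v
    calc c v ≤ hausdorffContent X ht (⋃ e ∈ Finset.univ.filter (fun e => G.ini e = v),
          f e '' F (G.ter e)) + hausdorffContent X ht (C v) :=
          (MeasureTheory.measure_mono hsub').trans (MeasureTheory.measure_union_le _ _)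
      _ = hausdorffContent X ht (⋃ e ∈ Finset.univ.filter (fun e => G.ini e = v),
          f e '' F (G.ter e)) := by rw [hC0, add_zero]
      _ ≤ ∑ e with G.ini e = v, hausdorffContent X ht (f e '' F (G.ter e)) :=
          MeasureTheory.measure_biUnion_finset_le _ _
      _ ≤ _ := Finset.sum_le_sum fun e _ => by
          rw [← ENNReal.ofReal_rpow_of_pos (hr e)]
          exact (lipschitzWith_of_dist_eq (hr e) (hf e)).hausdorffContent_image_le
            (Real.toNNReal_pos.2 (hr e)).ne' ht _
  have hreal : ∀ v, (c v).toReal ≤ ∑ e with G.ini e = v, r e ^ t * (c (G.ter e)).toReal := by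
    intro v
    have hft : ∀ e ∈ Finset.univ.filter (fun e => G.ini e = v),
        ENNReal.ofReal (r e ^ t) * c (G.ter e) ≠ ⊤ := fun e _ =>
      ENNReal.mul_ne_top ENNReal.ofReal_ne_top (hfin _)
    have := ENNReal.toReal_mono (ENNReal.sum_ne_top.2 hft) (hstep v)
    rw [ENNReal.toReal_sum hft] at this
    refine this.trans_eq (Finset.sum_congr rfl fun e _ => ?_)
    rw [ENNReal.toReal_mul, ENNReal.toReal_ofReal (Real.rpow_nonneg (hr e).le _)]
  obtain ⟨h, h0, hsum⟩ := hG
  have := Nonempty.intro v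
  obtain ⟨m, hm⟩ := Finite.exists_max fun v => (c v).toReal / h v
  set l := (c m).toReal / h m with hl
  have hle : ∀ v, (c v).toReal ≤ l * h v := fun v => (div_le_iff₀ (h0 v)).1 (hm v)
  have hl0 : l ≤ 0 := by
    by_contra! hpos
    have h1 : (c m).toReal ≤ l * ∑ e with G.ini e = m, r e ^ t * h (G.ter e) := by
      refine (hreal m).trans ?_
      rw [Finset.mul_sum]
      refine Finset.sum_le_sum fun e _ => ?_
      calc r e ^ t * (c (G.ter e)).toReal ≤ r e ^ t * (l * h (G.ter e)) :=
            mul_le_mul_of_nonneg_left (hle _) (Real.rpow_nonneg (hr e).le _)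
        _ = _ := by ring
    have h2 : (c m).toReal = l * h m := by rw [hl, div_mul_cancel₀ _ (h0 m).ne']
    rw [h2] at h1
    exact absurd (le_of_mul_le_mul_left h1 hpos) (not_le.2 (hsum m))
  have hcv : c v = 0 := by
    have h1 : (c v).toReal ≤ 0 := (hle v).trans (mul_nonpos_of_nonpos_of_nonneg hl0 (h0 v).le)
    exact ((ENNReal.toReal_eq_zero_iff _).1 (le_antisymm h1 ENNReal.toReal_nonneg)).resolve_right
      (hfin v)
  refine dimH_le_of_hausdorffMeasure_ne_top (d := t.toNNReal) ?_
  rw [htc, hausdorffMeasure_eq_zero_of_hausdorffContent_eq_zero ht hcv]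
  exact ENNReal.zero_ne_top

end Attractor

/-! ### Cover bounds and the dimension estimates they imply -/

/-- Every finite cover of `A` by sets of diameters at most `δ i` satisfies `c ≤ ∑ δ i ^ t`, for
some constant `c > 0`. -/
def HasCoverBound {X : Type*} [PseudoEMetricSpace X] (t : ℝ) (A : Set X) : Prop :=
  ∃ c : ℝ, 0 < c ∧ ∀ (ι : Finset ℕ) (s : ℕ → Set X) (δ : ℕ → ℝ),
    (∀ i ∈ ι, 0 < δ i ∧ Metric.ediam (s i) ≤ ENNReal.ofReal (δ i)) → A ⊆ ⋃ i ∈ ι, s i →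
      c ≤ ∑ i ∈ ι, δ i ^ t

namespace HasCoverBound

theorem mono {X : Type*} [PseudoEMetricSpace X] {t : ℝ} {A B : Set X} (h : HasCoverBound t A)
    (hAB : A ⊆ B) : HasCoverBound t B := by
  obtain ⟨c, hc, h⟩ := h
  exact ⟨c, hc, fun ι s δ hδ hB => h ι s δ hδ (hAB.trans hB)⟩

theorem image {X Y : Type*} [PseudoMetricSpace X] [PseudoMetricSpace Y] {t : ℝ} {A : Set X}
    (h : HasCoverBound t A) {f : X → Y} {r : ℝ} (hr : 0 < r)
    (hf : ∀ x y, dist (f x) (f y) = r * dist x y) : HasCoverBound t (f '' A) := by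
  obtain ⟨c, hc, h⟩ := h
  refine ⟨c * r ^ t, mul_pos hc (Real.rpow_pos_of_pos hr _), fun ι s δ hδ hA => ?_⟩
  have key := h ι (fun i => f ⁻¹' s i) (fun i => r⁻¹ * δ i) (fun i hi => ⟨?_, ?_⟩) ?_
  · have h1 : ∑ i ∈ ι, (r⁻¹ * δ i) ^ t = (∑ i ∈ ι, δ i ^ t) / r ^ t := by
      rw [Finset.sum_div]
      refine Finset.sum_congr rfl fun i hi => ?_
      rw [Real.mul_rpow (inv_nonneg.2 hr.le) (hδ i hi).1.le, Real.inv_rpow hr.le, inv_mul_eq_div]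
    rwa [h1, le_div_iff₀ (Real.rpow_pos_of_pos hr _)] at key
  · exact mul_pos (inv_pos.2 hr) (hδ i hi).1
  · refine ((antilipschitzWith_of_dist_eq hr hf).ediam_preimage_le _).trans ?_
    rw [ENNReal.ofReal_mul (inv_nonneg.2 hr.le)]
    gcongr
    · exact le_rfl
    · exact (hδ i hi).2
  · simpa [image_subset_iff] using hA

theorem le_upperBoxDim {X : Type*} [PseudoMetricSpace X] {t : ℝ} {A : Set X}
    (h : HasCoverBound t A) (hA : IsCompact A) : (t : EReal) ≤ upperBoxDim A := by
  obtain ⟨c, hc, h⟩ := h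
  refine le_upperBoxDim_of_le_coverNum hc fun δ hδ _ => ?_
  obtain ⟨s, hs, hcov⟩ := hA.exists_coverNum_cover hδ
  have key := h (Finset.range (coverNum δ A))
    (fun i => if hi : i < coverNum δ A then s ⟨i, hi⟩ else ∅) (fun _ => δ)
    (fun i hi => ⟨hδ, by simpa [Finset.mem_range.1 hi] using hs _⟩) ?_
  · rw [Finset.sum_const, Finset.card_range, nsmul_eq_mul] at key
    rwa [Real.rpow_neg hδ.le, ← div_eq_mul_inv, div_le_iff₀ (Real.rpow_pos_of_pos hδ _)]
  · refine hcov.trans (iUnion_subset fun i => ?_)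
    refine subset_biUnion_of_mem (u := fun j => if hi : j < coverNum δ A then s ⟨j, hi⟩ else ∅)
      (x := (i : ℕ)) (Finset.mem_coe.2 (Finset.mem_range.2 i.2)) |>.trans' ?_
    simp

/-- A countable cover of sum below c / 2 can be thickened to an open one at a further cost below c /
2; a finite subcover then contradicts the bound. -/
theorem hausdorffContent_pos {X : Type*} [PseudoMetricSpace X] {t : ℝ} {A : Set X}
    (h : HasCoverBound t A) (hA : IsCompact A) (ht : 0 < t) : hausdorffContent X ht A ≠ 0 := by
  obtain ⟨c, hc, h⟩ := h
  intro h0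
  have hlt : hausdorffContent X ht A < ENNReal.ofReal (c / 2) := by
    rw [h0]
    exact ENNReal.ofReal_pos.2 (half_pos hc)
  rw [hausdorffContent_apply] at hlt
  simp only [iInf_lt_iff, exists_prop] at hlt
  obtain ⟨s, hs, hsum⟩ := hlt
  obtain ⟨η, hη, hηsum⟩ := ENNReal.exists_pos_sum_of_countable
    (ε := ENNReal.ofReal (c / 2)) (ENNReal.ofReal_pos.2 (half_pos hc)).ne' ℕ
  have hdfin : ∀ i, Metric.ediam (s i) ≠ ⊤ := by
    intro i hi
    have h1 := (ENNReal.le_tsum (f := fun n => Metric.ediam (s n) ^ t) i).trans hsum.le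
    simp only [hi, ENNReal.top_rpow_of_pos ht, top_le_iff] at h1
    exact ENNReal.ofReal_ne_top h1
  have hτ : ∀ i, ∃ τ : NNReal, 0 < τ ∧
      ((Metric.ediam (s i)).toReal + 2 * τ) ^ t ≤ (Metric.ediam (s i)).toReal ^ t + η i := by
    intro i
    have hcont : Tendsto (fun τ : ℝ => ((Metric.ediam (s i)).toReal + 2 * τ) ^ t) (𝓝[>] 0)
        (𝓝 (((Metric.ediam (s i)).toReal + 2 * 0) ^ t)) :=
      (((continuous_const.add (continuous_const.mul continuous_id)).rpow_const
        fun _ => Or.inr ht.le).tendsto 0).mono_left nhdsWithin_le_nhds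
    have hlt : ((Metric.ediam (s i)).toReal + 2 * 0) ^ t <
        (Metric.ediam (s i)).toReal ^ t + η i := by
      rw [mul_zero, add_zero]
      exact lt_add_of_pos_right _ (hη i)
    obtain ⟨τ, h1, h2⟩ := ((hcont.eventually_lt_const hlt).and self_mem_nhdsWithin).exists
    have h2 : 0 < τ := h2
    exact ⟨⟨τ, h2.le⟩, h2, h1.le⟩
  choose τ hτ0 hτ using hτ
  obtain ⟨ι, hι⟩ := hA.elim_finite_subcover (fun i => Metric.thickening (τ i) (s i))
    (fun i => Metric.isOpen_thickening)
    (hs.trans (iUnion_mono fun i => Metric.self_subset_thickening (hτ0 i) _))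
  have key := h ι _ (fun i => (Metric.ediam (s i)).toReal + 2 * τ i) (fun i _ => ⟨?_, ?_⟩) hι
  · have h1 : ENNReal.ofReal c ≤ ∑ i ∈ ι, (Metric.ediam (s i) ^ t + η i) := by
      refine (ENNReal.ofReal_le_ofReal (key.trans (Finset.sum_le_sum fun i _ => hτ i))).trans ?_
      rw [ENNReal.ofReal_sum_of_nonneg fun i _ => by positivity]
      refine Finset.sum_le_sum fun i _ => ?_
      rw [ENNReal.ofReal_add (by positivity) (by positivity),
        ← ENNReal.ofReal_rpow_of_nonneg ENNReal.toReal_nonneg ht.le,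
        ENNReal.ofReal_toReal (hdfin i), ENNReal.ofReal_coe_nnreal]
    have h2 : ∑ i ∈ ι, (Metric.ediam (s i) ^ t + (η i : ENNReal)) < ENNReal.ofReal c := by
      rw [Finset.sum_add_distrib, ← add_halves c, ENNReal.ofReal_add (half_pos hc).le
        (half_pos hc).le]
      exact ENNReal.add_lt_add ((ENNReal.sum_le_tsum ι).trans_lt hsum)
        ((ENNReal.sum_le_tsum ι).trans_lt hηsum)
    exact absurd h1 (not_le.2 h2)
  · have := hτ0 i
    positivity
  · refine (Metric.ediam_thickening_le _).trans_eq ?_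
    rw [ENNReal.ofReal_add ENNReal.toReal_nonneg (by positivity), ENNReal.ofReal_toReal (hdfin i),
      ENNReal.ofReal_mul zero_le_two, ENNReal.ofReal_ofNat, ENNReal.ofReal_coe_nnreal]

theorem le_dimH {X : Type*} [MetricSpace X] {t : ℝ} {A : Set X}
    (h : HasCoverBound t A) (hA : IsCompact A) (ht : 0 < t) : ENNReal.ofReal t ≤ dimH A := by
  borelize X
  refine le_dimH_of_hausdorffMeasure_ne_zero (d := t.toNNReal) fun h0 =>
    h.hausdorffContent_pos hA ht (le_antisymm ?_ zero_le)
  rw [Real.coe_toNNReal _ ht.le] at h0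
  exact (hausdorffContent_le_hausdorffMeasure ht A).trans h0.le

end HasCoverBound

/-! ### Finite-level mass distribution, in place of a limit measure -/

section EdgeMass

variable {V E X : Type*} [Fintype E] [DecidableEq V]

open Classical in
/-- The mass of the level `k` cylinder sets of the attractor component `F v` that meet `A`, when
`F v` has mass `h v` and the edges distribute mass with the weights `w`. -/
noncomputable def edgeMass (G : DirGraph V E) (f : E → X → X) (w : E → ℝ) (h : V → ℝ)
    (F : V → Set X) : ℕ → V → Set X → ℝ
  | 0, v, A => if (F v ∩ A).Nonempty then h v else 0
  | k + 1, v, A => ∑ e with G.ini e = v, w e * edgeMass G f w h F k (G.ter e) (f e ⁻¹' A)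

variable {G : DirGraph V E} {f : E → X → X} {w : E → ℝ} {h : V → ℝ} {F : V → Set X}

theorem edgeMass_nonneg (hw : ∀ e, 0 ≤ w e) (hh : ∀ v, 0 ≤ h v) (k : ℕ) (v : V) (A : Set X) :
    0 ≤ edgeMass G f w h F k v A := by
  induction k generalizing v A with
  | zero =>
    rw [edgeMass]
    split_ifs
    exacts [hh v, le_rfl]
  | succ k ih => exact Finset.sum_nonneg fun e _ => mul_nonneg (hw e) (ih _ _)

/-- Refining cylinders preserves total mass and can only discard pieces that miss `A`. -/
theorem edgeMass_le_zero (hw : ∀ e, 0 ≤ w e) (hh : ∀ v, 0 ≤ h v)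
    (hwh : ∀ v, ∑ e with G.ini e = v, w e * h (G.ter e) = h v)
    (hF : ∀ e, f e '' F (G.ter e) ⊆ F (G.ini e)) (k : ℕ) (v : V) (A : Set X) :
    edgeMass G f w h F k v A ≤ edgeMass G f w h F 0 v A := by
  induction k generalizing v A with
  | zero => exact le_rfl
  | succ k ih =>
    rw [edgeMass]
    refine (Finset.sum_le_sum fun e _ => mul_le_mul_of_nonneg_left (ih _ _) (hw e)).trans ?_
    simp only [edgeMass]
    split_ifs with hA
    · rw [← hwh v]
      refine Finset.sum_le_sum fun e _ => mul_le_mul_of_nonneg_left ?_ (hw e)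
      split_ifs
      exacts [le_rfl, hh _]
    · refine Finset.sum_nonpos fun e he => ?_
      rw [if_neg, mul_zero]
      rintro ⟨x, hx, hxA⟩
      have := hF e (mem_image_of_mem _ hx)
      rw [(Finset.mem_filter.1 he).2] at this
      exact hA ⟨_, this, hxA⟩

theorem edgeMass_of_subset (hwh : ∀ v, ∑ e with G.ini e = v, w e * h (G.ter e) = h v)
    (hF : ∀ e, f e '' F (G.ter e) ⊆ F (G.ini e)) (hne : ∀ v, (F v).Nonempty) (k : ℕ) {v : V}
    {A : Set X} (hA : F v ⊆ A) : edgeMass G f w h F k v A = h v := by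
  induction k generalizing v A with
  | zero => rw [edgeMass, inter_eq_left.2 hA, if_pos (hne v)]
  | succ k ih =>
    rw [edgeMass, ← hwh v]
    refine Finset.sum_congr rfl fun e he => ?_
    rw [ih]
    have := hF e
    rw [(Finset.mem_filter.1 he).2, image_subset_iff] at this
    exact this.trans (preimage_mono hA)

theorem edgeMass_biUnion_le (hw : ∀ e, 0 ≤ w e) (hh : ∀ v, 0 ≤ h v) {I : Type*} (ι : Finset I)
    (k : ℕ) (v : V) (s : I → Set X) :
    edgeMass G f w h F k v (⋃ i ∈ ι, s i) ≤ ∑ i ∈ ι, edgeMass G f w h F k v (s i) := by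
  induction k generalizing v s with
  | zero =>
    rw [edgeMass]
    split_ifs with hne
    · obtain ⟨x, hx, hxs⟩ := hne
      simp only [mem_iUnion] at hxs
      obtain ⟨i, hi, hxi⟩ := hxs
      refine le_trans (le_of_eq ?_) (Finset.single_le_sum
        (fun i _ => edgeMass_nonneg hw hh 0 v (s i)) hi)
      rw [edgeMass, if_pos ⟨x, hx, hxi⟩]
    · exact Finset.sum_nonneg fun i _ => edgeMass_nonneg hw hh 0 v (s i)
  | succ k ih =>
    simp only [edgeMass, preimage_iUnion]
    rw [Finset.sum_comm]
    refine Finset.sum_le_sum fun e _ => ?_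
    rw [← Finset.mul_sum]
    exact mul_le_mul_of_nonneg_left (ih _ _) (hw e)

end EdgeMass

/-! ### Lower bound from the open set condition -/

section LowerBound

open MeasureTheory Module

variable {X : Type*} [NormedAddCommGroup X] [NormedSpace ℝ X] [FiniteDimensional ℝ X]
  [MeasurableSpace X] [BorelSpace X]

theorem rpow_mul_hausdorffMeasure_real_le_image {f : X → X} {r : ℝ} (hr : 0 < r)
    (hf : ∀ x y, dist (f x) (f y) = r * dist x y) {A : Set X} (hA : Bornology.IsBounded A) :
    r ^ finrank ℝ X * (Measure.hausdorffMeasure (finrank ℝ X) : Measure X).real A ≤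
      (Measure.hausdorffMeasure (finrank ℝ X) : Measure X).real (f '' A) := by
  have hfin : (Measure.hausdorffMeasure (finrank ℝ X) : Measure X) (f '' A) ≠ ⊤ :=
    ((lipschitzWith_of_dist_eq hr hf).isBounded_image hA).measure_lt_top.ne
  have h1 := (antilipschitzWith_of_dist_eq hr hf).le_hausdorffMeasure_image
    (Nat.cast_nonneg (finrank ℝ X)) A
  rw [ENNReal.rpow_natCast] at h1
  have h2 := ENNReal.toReal_mono (by finiteness) h1
  rw [ENNReal.toReal_mul, ENNReal.toReal_pow, ENNReal.coe_toReal,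
    Real.coe_toNNReal _ (inv_nonneg.2 hr.le), inv_pow] at h2
  rwa [← le_inv_mul_iff₀ (pow_pos hr _)]

variable {V E : Type*} [Fintype E] [DecidableEq V] {G : DirGraph V E} {f : E → X → X}
  {r w : E → ℝ} {h : V → ℝ} {F U : V → Set X}

/-- Induction on scale. Passing through an edge costs at most r ^ t in mass and gains r ^ n in
volume, which the factor δ ^ (t - n) balances exactly; the images of the open sets are disjoint, so
their volumes add up inside U v. -/
theorem edgeMass_le_measure [Finite V] {t a b L : ℝ} (ht : 0 ≤ t) (ha : 0 < a)
    (hb : 0 < b) (hb1 : b < 1) (hab : ∀ e, a ≤ r e ∧ r e ≤ b)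
    (hf : ∀ e x y, dist (f e x) (f e y) = r e * dist x y)
    (hw : ∀ e, 0 ≤ w e) (hwr : ∀ e, w e ≤ r e ^ t) (hh : ∀ v, 0 ≤ h v)
    (hwh : ∀ v, ∑ e with G.ini e = v, w e * h (G.ter e) = h v)
    (hF : ∀ e, f e '' F (G.ter e) ⊆ F (G.ini e))
    (hU : ∀ v, IsOpen (U v) ∧ (U v).Nonempty ∧ Bornology.IsBounded (U v))
    (hfU : ∀ e, f e '' U (G.ter e) ⊆ U (G.ini e))
    (hdisj : ∀ e e', e ≠ e' → G.ini e = G.ini e' →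
      Disjoint (f e '' U (G.ter e)) (f e' '' U (G.ter e')))
    (hL : ∀ v, ∀ x ∈ F v, ∀ y ∈ U v, dist y x < L) (hL0 : 0 < L) :
    ∃ K : ℝ, 0 < K ∧ ∀ j k : ℕ, j ≤ k → ∀ (v : V) (A : Set X) (δ : ℝ), b ^ j ≤ δ → δ ≤ a⁻¹ →
      edgeMass G f w h F k v A ≤ K * δ ^ (t - finrank ℝ X) *
        (Measure.hausdorffMeasure (finrank ℝ X) : Measure X).real
          (U v ∩ Metric.thickening (L * δ) A) := by
  set n := finrank ℝ X with hn
  set μ : Measure X := Measure.hausdorffMeasure (n : ℝ) with hμ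
  have hr : ∀ e, 0 < r e := fun e => ha.trans_le (hab e).1
  have hfin : ∀ v (B : Set X), B ⊆ U v → μ B ≠ ⊤ := fun v B hB =>
    ((hU v).2.2.subset hB).measure_lt_top.ne
  have hUpos : ∀ v, 0 < μ.real (U v) := fun v =>
    ENNReal.toReal_pos ((hU v).1.measure_pos μ (hU v).2.1).ne' (hfin v _ subset_rfl)
  -- On 1 ≤ δ ≤ a⁻¹ one has δ ^ (t - n) ≥ a ^ n, and the thickening of any `A` meeting `F v`
  -- swallows `U v`.
  have hlarge : ∀ᶠ K : ℝ in atTop, 0 < K ∧ ∀ v, h v ≤ K * (a ^ n * μ.real (U v)) :=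
    (eventually_gt_atTop 0).and (eventually_all.2 fun v =>
      (tendsto_id.atTop_mul_const (mul_pos (pow_pos ha n) (hUpos v))).eventually_ge_atTop _)
  obtain ⟨K, hK0, hK⟩ := hlarge.exists
  refine ⟨K, hK0, fun j => ?_⟩
  induction j with
  | zero =>
    intro k _ v A δ h1 h2
    rw [pow_zero] at h1
    have hδ : 0 < δ := one_pos.trans_le h1
    refine (edgeMass_le_zero hw hh hwh hF k v A).trans ?_
    rw [edgeMass]
    split_ifs with hA
    · obtain ⟨x, hx, hxA⟩ := hA
      have hUA : U v ∩ Metric.thickening (L * δ) A = U v :=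
        inter_eq_left.2 fun y hy => Metric.mem_thickening_iff.2
          ⟨x, hxA, (hL v x hx y hy).trans_le (le_mul_of_one_le_right hL0.le h1)⟩
      rw [hUA, mul_assoc]
      refine (hK v).trans ?_
      gcongr
      calc a ^ n = (a⁻¹ ^ n)⁻¹ := by rw [inv_pow, inv_inv]
        _ ≤ (δ ^ n)⁻¹ := by gcongr
        _ = δ ^ (-(n : ℝ)) := by rw [Real.rpow_neg hδ.le, Real.rpow_natCast]
        _ ≤ δ ^ (t - n) := Real.rpow_le_rpow_of_exponent_le h1 (by linarith)
    · positivity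
  | succ j ih =>
    intro k hjk v A δ h1 h2
    rcases le_or_gt (b ^ j) δ with h3 | h3
    · exact ih k (by omega) v A δ h3 h2
    obtain ⟨k, rfl⟩ : ∃ k', k = k' + 1 := ⟨k - 1, by omega⟩
    have hδ : 0 < δ := (pow_pos hb _).trans_le h1
    have hδ1 : δ < 1 := h3.trans_le (pow_le_one₀ hb.le hb1.le)
    set N := Metric.thickening (L * δ) A with hN
    have hstep : ∀ e, w e * edgeMass G f w h F k (G.ter e) (f e ⁻¹' A) ≤
        K * δ ^ (t - n) * μ.real (f e '' U (G.ter e) ∩ N) := by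
      intro e
      set B := U (G.ter e) ∩ Metric.thickening (L * (δ / r e)) (f e ⁻¹' A) with hB
      have hmass : edgeMass G f w h F k (G.ter e) (f e ⁻¹' A) ≤
          K * (δ / r e) ^ (t - n) * μ.real B := by
        refine ih k (by omega) _ _ _ ?_ ?_
        · rw [le_div_iff₀ (hr e)]
          calc b ^ j * r e ≤ b ^ j * b := by gcongr; exact (hab e).2
            _ ≤ δ := by rwa [← pow_succ]
        · rw [div_le_iff₀ (hr e), inv_mul_eq_div, le_div_iff₀ ha]
          nlinarith [(hab e).1]
      have himage : f e '' B ⊆ f e '' U (G.ter e) ∩ N := by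
        rintro _ ⟨x, ⟨hxU, hx⟩, rfl⟩
        refine ⟨mem_image_of_mem _ hxU, ?_⟩
        obtain ⟨z, hz, hxz⟩ := Metric.mem_thickening_iff.1 hx
        refine Metric.mem_thickening_iff.2 ⟨f e z, hz, ?_⟩
        rw [hf]
        calc r e * dist x z < r e * (L * (δ / r e)) := mul_lt_mul_of_pos_left hxz (hr e)
          _ = L * δ := by field_simp [(hr e).ne']
      have hscale : r e ^ n * μ.real B ≤ μ.real (f e '' U (G.ter e) ∩ N) :=
        (rpow_mul_hausdorffMeasure_real_le_image (hr e) (hf e)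
          ((hU _).2.2.subset inter_subset_left)).trans
          (measureReal_mono himage (hfin _ _ (inter_subset_left.trans (hfU e))))
      calc w e * edgeMass G f w h F k (G.ter e) (f e ⁻¹' A)
          ≤ r e ^ t * (K * (δ / r e) ^ (t - n) * μ.real B) :=
            mul_le_mul (hwr e) hmass (edgeMass_nonneg hw hh _ _ _)
              (Real.rpow_nonneg (hr e).le _)
        _ = K * δ ^ (t - n) * (r e ^ n * μ.real B) := by
            rw [Real.div_rpow hδ.le (hr e).le, Real.rpow_sub (hr e), Real.rpow_natCast]
            have := Real.rpow_pos_of_pos (hr e) t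
            have := pow_pos (hr e) n
            field_simp
        _ ≤ _ := by gcongr
    rw [edgeMass]
    refine (Finset.sum_le_sum fun e _ => hstep e).trans ?_
    rw [← Finset.mul_sum]
    gcongr
    rw [← measureReal_biUnion_finset (f := fun e => f e '' U (G.ter e) ∩ N)
      (h := fun e _ => hfin _ _ (inter_subset_left.trans (hfU e)))]
    · refine measureReal_mono (iUnion₂_subset fun e he => ?_) (hfin v _ inter_subset_left)
      have := hfU e
      rw [(Finset.mem_filter.1 he).2] at this
      exact inter_subset_inter_left _ this
    · intro e he e' he' hne
      refine (hdisj e e' hne ?_).mono inter_subset_left inter_subset_left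
      rw [(Finset.mem_filter.1 (Finset.mem_coe.1 he)).2,
        (Finset.mem_filter.1 (Finset.mem_coe.1 he')).2]
    · intro e _
      exact ((hU _).1.measurableSet.image_of_continuousOn_injOn
        (lipschitzWith_of_dist_eq (hr e) (hf e)).continuous.continuousOn
        (antilipschitzWith_of_dist_eq (hr e) (hf e)).injective.injOn).inter
        Metric.isOpen_thickening.measurableSet

theorem hausdorffMeasure_real_thickening_le {A : Set X} {δ L : ℝ} (hδ : 0 < δ) (hL : 0 < L)
    (hA : Metric.ediam A ≤ ENNReal.ofReal δ) :
    (Measure.hausdorffMeasure (finrank ℝ X) : Measure X).real (Metric.thickening (L * δ) A) ≤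
      ((L + 2) * δ) ^ finrank ℝ X *
        (Measure.hausdorffMeasure (finrank ℝ X) : Measure X).real (Metric.ball 0 1) := by
  rcases A.eq_empty_or_nonempty with rfl | ⟨x, hx⟩
  · rw [Metric.thickening_empty, measureReal_empty]
    positivity
  · have hsub : Metric.thickening (L * δ) A ⊆ Metric.ball x ((L + 2) * δ) := by
      intro y hy
      obtain ⟨z, hz, hyz⟩ := Metric.mem_thickening_iff.1 hy
      have hzx : dist z x ≤ δ := by
        have := (Metric.edist_le_ediam_of_mem hz hx).trans hA
        rwa [edist_dist, ENNReal.ofReal_le_ofReal_iff hδ.le] at this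
      have := dist_triangle y z x
      rw [Metric.mem_ball]
      linarith
    refine (measureReal_mono hsub Metric.isBounded_ball.measure_lt_top.ne).trans_eq ?_
    rw [Measure.real, Measure.addHaar_ball_of_pos _ _ (by positivity), ENNReal.toReal_mul,
      ENNReal.toReal_ofReal (by positivity), Measure.real]

/-- Mass distribution principle: a set of diameter at most δ ≤ 1 carries mass at most K' δ ^ t,
while a cover carries the full mass h v. The bound is obtained only at a vertex with h v > 0. -/
theorem exists_hasCoverBound [Finite V] {t : ℝ} (ht : 0 ≤ t) (hr : ∀ e, 0 < r e)
    (hr1 : ∀ e, r e < 1) (hf : ∀ e x y, dist (f e x) (f e y) = r e * dist x y)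
    (hG : G.Superinvariant fun e => r e ^ t)
    (hF : ∀ e, f e '' F (G.ter e) ⊆ F (G.ini e)) (hne : ∀ v, (F v).Nonempty)
    (hbdd : ∀ v, Bornology.IsBounded (F v))
    (hU : ∀ v, IsOpen (U v) ∧ (U v).Nonempty ∧ Bornology.IsBounded (U v))
    (hfU : ∀ e, f e '' U (G.ter e) ⊆ U (G.ini e))
    (hdisj : ∀ e e', e ≠ e' → G.ini e = G.ini e' →
      Disjoint (f e '' U (G.ter e)) (f e' '' U (G.ter e'))) :
    ∃ v, HasCoverBound t (F v) := by
  obtain ⟨a, b, ha, ha1, hb, hb1, hab⟩ := exists_ratio_bounds hr hr1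
  obtain ⟨w, h, hw, hwr, hh, ⟨v, hv⟩, hwh⟩ :=
    hG.exists_invariant_weights fun e => Real.rpow_nonneg (hr e).le t
  have hL : ∀ᶠ L : ℝ in atTop, 0 < L ∧ ∀ v, ∀ x ∈ F v, ∀ y ∈ U v, dist y x < L := by
    refine (eventually_gt_atTop 0).and (eventually_all.2 fun v => ?_)
    filter_upwards [eventually_gt_atTop (Metric.diam (F v ∪ U v))] with L hL x hx y hy
    exact (Metric.dist_le_diam_of_mem ((hbdd v).union (hU v).2.2) (Or.inr hy)
      (Or.inl hx)).trans_lt hL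
  obtain ⟨L, hL0, hL⟩ := hL.exists
  obtain ⟨K, hK0, hK⟩ :=
    edgeMass_le_measure ht ha hb hb1 hab hf hw hwr hh hwh hF hU hfU hdisj hL hL0
  set n := finrank ℝ X with hn
  set μ : Measure X := Measure.hausdorffMeasure (n : ℝ) with hμ
  have hball : 0 < μ.real (Metric.ball 0 1) :=
    ENNReal.toReal_pos (Metric.isOpen_ball.measure_pos μ ⟨0, by simp⟩).ne'
      Metric.isBounded_ball.measure_lt_top.ne
  set K' : ℝ := K * ((L + 2) ^ n * μ.real (Metric.ball 0 1)) with hK'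
  have hK'0 : 0 < K' := by positivity
  have hmass : ∀ j v (A : Set X) δ, b ^ j ≤ δ → δ ≤ 1 → Metric.ediam A ≤ ENNReal.ofReal δ →
      edgeMass G f w h F j v A ≤ K' * δ ^ t := by
    intro j v A δ h1 h2 h3
    have hδ : 0 < δ := (pow_pos hb _).trans_le h1
    refine (hK j j le_rfl v A δ h1 (h2.trans (one_le_inv_iff₀.2 ⟨ha, ha1.le⟩))).trans ?_
    have hfin : μ (Metric.thickening (L * δ) A) ≠ ⊤ := by
      refine Bornology.IsBounded.measure_lt_top ?_ |>.ne
      exact (Metric.isBounded_iff_ediam_ne_top.2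
        (h3.trans_lt ENNReal.ofReal_lt_top).ne).thickening
    calc K * δ ^ (t - n) * μ.real (U v ∩ Metric.thickening (L * δ) A)
        ≤ K * δ ^ (t - n) * (((L + 2) * δ) ^ n * μ.real (Metric.ball 0 1)) := by
          gcongr
          exact (measureReal_mono inter_subset_right hfin).trans
            (hausdorffMeasure_real_thickening_le hδ hL0 h3)
      _ = K' * δ ^ t := by
          rw [Real.rpow_sub hδ, Real.rpow_natCast, mul_pow, hK']
          have := pow_pos hδ n
          field_simp
  -- The 1 handles covers with some δ i > 1. Otherwise the level j is chosen after the cover, deep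
  -- enough for its finitely many scales.
  refine ⟨v, min 1 (h v / K'), lt_min one_pos (div_pos hv hK'0), fun ι s δ hs hcov => ?_⟩
  by_cases hδ1 : ∀ i ∈ ι, δ i ≤ 1
  · have hj : ∀ᶠ j : ℕ in atTop, ∀ i ∈ ι, b ^ j ≤ δ i := by
      refine (Finset.eventually_all ι).2 fun i hi => ?_
      exact (tendsto_pow_atTop_nhds_zero_of_lt_one hb.le hb1).eventually_le_const (hs i hi).1
    obtain ⟨j, hj⟩ := hj.exists
    refine (min_le_right _ _).trans ?_
    rw [div_le_iff₀' hK'0, Finset.mul_sum, ← edgeMass_of_subset hwh hF hne j hcov]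
    exact (edgeMass_biUnion_le hw hh ι j v s).trans
      (Finset.sum_le_sum fun i hi => hmass j v _ _ (hj i hi) (hδ1 i hi) (hs i hi).2)
  · push Not at hδ1
    obtain ⟨i, hi, hi1⟩ := hδ1
    refine (min_le_left _ _).trans ((Real.one_le_rpow hi1.le ht).trans ?_)
    exact Finset.single_le_sum (f := fun i => δ i ^ t)
      (fun i hi => Real.rpow_nonneg (hs i hi).1.le _) hi

end LowerBound

/-- Along a path to the good vertex, each component contains a similar copy of the next one. -/
theorem DirGraph.StronglyConnected.hasCoverBound_of_exists {V E X : Type*} [PseudoMetricSpace X]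
    {G : DirGraph V E} (hG : G.StronglyConnected) {f : E → X → X} {r : E → ℝ} {F : V → Set X}
    {t : ℝ}
    (hr : ∀ e, 0 < r e) (hf : ∀ e x y, dist (f e x) (f e y) = r e * dist x y)
    (hF : ∀ e, f e '' F (G.ter e) ⊆ F (G.ini e)) (hex : ∃ v, HasCoverBound t (F v)) (v : V) :
    HasCoverBound t (F v) := by
  obtain ⟨u, hu⟩ := hex
  induction hG v u using Relation.ReflTransGen.head_induction_on with
  | refl => exact hu
  | head hstep _ ih =>
    obtain ⟨e, rfl, rfl⟩ := hstep
    exact (ih.image (hr e) (hf e)).mono (hF e)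

/-- A continuity principle: quantities `D r ≥ c` that are bounded above by every admissible `ι t`
with subinvariant weights `r ^ t`, and below by every `ι t` with superinvariant weights, depend
continuously on the ratios `r`. -/
theorem DirGraph.tendsto_of_dichotomy {V E α : Type*} [Finite V] [Fintype E] [DecidableEq V]
    [LinearOrder α] [TopologicalSpace α] [OrderTopology α] (G : DirGraph V E) {ι : ℝ → α}
    {c D : α} {Dn : ℕ → α} {r : E → ℝ} {rn : ℕ → E → ℝ}
    (hdense : ∀ a b, c ≤ a → a < b → ∃ t, 0 < t ∧ a < ι t ∧ ι t < b)
    (hmono : ∀ t t', ι t < ι t' → t < t')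
    (hr : ∀ e, 0 < r e) (hr1 : ∀ e, r e < 1)
    (hlim : ∀ e, Tendsto (fun n => rn n e) atTop (𝓝 (r e)))
    (hc : c ≤ D) (hcn : ∀ n, c ≤ Dn n)
    (hup : ∀ t, 0 < t → G.StrictlySubinvariant (fun e => r e ^ t) → c < ι t → D ≤ ι t)
    (hupn : ∀ n t, 0 < t → G.StrictlySubinvariant (fun e => rn n e ^ t) → c < ι t → Dn n ≤ ι t)
    (hlow : ∀ t, 0 < t → G.Superinvariant (fun e => r e ^ t) → ι t ≤ D)
    (hlown : ∀ n t, 0 < t → G.Superinvariant (fun e => rn n e ^ t) → ι t ≤ Dn n) :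
    Tendsto Dn atTop (𝓝 D) := by
  have := Fintype.ofFinite V
  have hpow : ∀ t : ℝ, ∀ e, Tendsto (fun n => rn n e ^ t) atTop (𝓝 (r e ^ t)) := fun t e =>
    (hlim e).rpow_const (Or.inl (hr e).ne')
  have hdich : ∀ t : ℝ, G.StrictlySubinvariant (fun e => r e ^ t) ∨
      G.Superinvariant (fun e => r e ^ t) := fun t =>
    G.strictlySubinvariant_or_superinvariant fun e => Real.rpow_nonneg (hr e).le t
  refine tendsto_order.2 ⟨fun a ha => ?_, fun a ha => ?_⟩
  · rcases lt_or_ge a c with hac | hac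
    · exact Eventually.of_forall fun n => hac.trans_le (hcn n)
    -- Two exponents t < t' are needed: superinvariance at t' passes to the nearby systems only at
    -- the smaller t, using r ^ t' < r ^ t.
    obtain ⟨t', ht', hat', htD'⟩ := hdense a D hac ha
    obtain ⟨t, ht, hat, htt⟩ := hdense a (ι t') hac hat'
    have hlt : t < t' := hmono t t' htt
    have hsup : G.Superinvariant (fun e => r e ^ t') :=
      (hdich t').resolve_left fun h => (hup t' ht' h (hac.trans_lt hat')).not_gt htD'
    have hev : ∀ᶠ n in atTop, ∀ e, r e ^ t' < rn n e ^ t :=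
      eventually_all.2 fun e => (hpow t e).eventually_const_lt
        (Real.rpow_lt_rpow_of_exponent_gt (hr e) (hr1 e) hlt)
    filter_upwards [hev] with n hn
    exact hat.trans_le (hlown n t ht (hsup.mono fun e => (hn e).le))
  · obtain ⟨t, ht, hDt, hta⟩ := hdense D a hc ha
    have hsub : G.StrictlySubinvariant (fun e => r e ^ t) :=
      (hdich t).resolve_right fun h => (hlow t ht h).not_gt hDt
    filter_upwards [hsub.eventually (hpow t)] with n hn
    exact (hupn n t ht hn (hc.trans_lt hDt)).trans_lt hta

/-! ### Ratios, attractors and the final assembly -/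

namespace GDIFS

variable {V E : Type*} {G : DirGraph V E} {d : ℕ} {C : V → NonemptyCompacts (VertexSpace d)}

/-- `r` is the list of ratios of the similarity maps of the system. -/
structure HasRatios (S : GDIFS G d C) (r : E → ℝ) : Prop where
  pos : ∀ e, 0 < r e
  lt_one : ∀ e, r e < 1
  dist_eq : ∀ e x y, dist (S.map e x) (S.map e y) = r e * dist x y

theorem hasRatios_of_dist_eq [NeZero d] (S : GDIFS G d C) {r : E → ℝ} (hr : ∀ e, 0 < r e)
    (h : ∀ e x y, dist (S.map e x) (S.map e y) = r e * dist x y) : S.HasRatios r := by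
  refine ⟨hr, fun e => ?_, h⟩
  obtain ⟨ρ, hρ⟩ := S.contracting e
  obtain ⟨x, y, hxy⟩ := exists_pair_ne (VertexSpace d)
  have h1 := hρ.2.dist_le_mul x y
  rw [h] at h1
  exact (le_of_mul_le_mul_right h1 (dist_pos.2 hxy)).trans_lt hρ.1

theorem IsSimilarity.exists_hasRatios [NeZero d] {S : GDIFS G d C} (hS : S.IsSimilarity) :
    ∃ r, S.HasRatios r := by
  choose r hr h using hS
  exact ⟨r, S.hasRatios_of_dist_eq hr h⟩

/-- Ratios can be read off from one pair of distinct points, so they converge; injectivity keeps the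
limit ratio positive. -/
theorem exists_hasRatios_of_tendsto [NeZero d] {Sn : ℕ → GDIFS G d C} {S : GDIFS G d C}
    {rn : ℕ → E → ℝ} (hrn : ∀ n, (Sn n).HasRatios (rn n))
    (hconv : ∀ e x, Tendsto (fun n => (Sn n).map e x) atTop (𝓝 (S.map e x)))
    (hinj : ∀ e, Function.Injective (S.map e)) :
    ∃ r, S.HasRatios r ∧ ∀ e, Tendsto (fun n => rn n e) atTop (𝓝 (r e)) := by
  obtain ⟨x, y, hxy⟩ := exists_pair_ne (VertexSpace d)
  have hd : 0 < dist x y := dist_pos.2 hxy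
  have hlim : ∀ e, Tendsto (fun n => rn n e) atTop
      (𝓝 (dist (S.map e x) (S.map e y) / dist x y)) := by
    intro e
    refine (((hconv e x).dist (hconv e y)).div_const (dist x y)).congr fun n => ?_
    rw [(hrn n).dist_eq, mul_div_cancel_right₀ _ hd.ne']
  refine ⟨_, S.hasRatios_of_dist_eq (fun e => div_pos (dist_pos.2 ((hinj e).ne hxy)) hd)
    fun e u v => ?_, hlim⟩
  refine tendsto_nhds_unique ((hconv e u).dist (hconv e v)) ?_
  exact ((hlim e).mul_const (dist u v)).congr fun n => ((hrn n).dist_eq e u v).symm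

namespace IsAttractor

variable {S : GDIFS G d C} {F : V → NonemptyCompacts (VertexSpace d)} {r : E → ℝ}

theorem condensation_subset (hF : S.IsAttractor F) (v : V) :
    (C v : Set (VertexSpace d)) ⊆ F v := by
  rw [hF v]
  exact subset_union_right

theorem image_subset (hF : S.IsAttractor F) (e : E) :
    S.map e '' (F (G.ter e) : Set (VertexSpace d)) ⊆ F (G.ini e) := by
  rw [hF (G.ini e)]
  exact subset_union_of_subset_left (subset_biUnion_of_mem
    (u := fun e => S.map e '' (F (G.ter e) : Set (VertexSpace d)))
    (show e ∈ {e' : E | G.ini e' = G.ini e} from rfl)) _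

theorem hasCoverBound [Finite V] [Fintype E] [DecidableEq V] (hF : S.IsAttractor F)
    (hG : G.StronglyConnected) (hr : S.HasRatios r) (hU : S.GDIOSC) {t : ℝ} (ht : 0 ≤ t)
    (hsup : G.Superinvariant fun e => r e ^ t) (v : V) :
    HasCoverBound t (F v : Set (VertexSpace d)) := by
  obtain ⟨U, hU, hfU, hdisj, -⟩ := hU
  refine hG.hasCoverBound_of_exists (F := fun v => (F v : Set (VertexSpace d)))
    hr.pos hr.dist_eq hF.image_subset ?_ v
  exact exists_hasCoverBound ht hr.pos hr.lt_one hr.dist_eq hsup hF.image_subset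
    (fun v => (F v).nonempty) (fun v => (F v).isCompact.isBounded) hU hfU hdisj

theorem upperBoxDim_le [Finite V] [Fintype E] [DecidableEq V] (hF : S.IsAttractor F)
    (hr : S.HasRatios r) {t : ℝ} (ht : 0 ≤ t)
    (hsub : G.StrictlySubinvariant fun e => r e ^ t)
    (hC : ∀ v, upperBoxDim (C v : Set (VertexSpace d)) < t) (v : V) :
    upperBoxDim (F v : Set (VertexSpace d)) ≤ t :=
  upperBoxDim_attractor_le (F := fun v => (F v : Set (VertexSpace d))) hr.pos hr.lt_one hr.dist_eq
    (fun v => (C v).isCompact) (fun v => (F v).isCompact) (fun v => (hF v).subset) ht hsub hC v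

theorem dimH_le [Finite V] [Fintype E] [DecidableEq V] (hF : S.IsAttractor F)
    (hr : S.HasRatios r) {t : ℝ} (ht : 0 < t)
    (hsub : G.StrictlySubinvariant fun e => r e ^ t)
    (hC : ∀ v, dimH (C v : Set (VertexSpace d)) < ENNReal.ofReal t) (v : V) :
    dimH (F v : Set (VertexSpace d)) ≤ ENNReal.ofReal t :=
  dimH_attractor_le (F := fun v => (F v : Set (VertexSpace d))) hr.pos hr.dist_eq
    (fun v => (F v).isCompact.isBounded) (fun v => (hF v).subset) ht hsub hC v

end IsAttractor

end GDIFS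

theorem mainTheorem7 {V E : Type*} [Finite V] [Finite E] (G : DirGraph V E)
    (hG : G.StronglyConnected) (d : ℕ) (C : V → NonemptyCompacts (VertexSpace d))
    (Sn : ℕ → GDIFS G d C) (S : GDIFS G d C)
    (hsim : ∀ n, (Sn n).IsSimilarity)
    (hconv : ∀ e x, Tendsto (fun n => (Sn n).map e x) atTop (𝓝 (S.map e x)))
    (hinj : ∀ e, Function.Injective (S.map e))
    (hOSCn : ∀ n, (Sn n).GDIOSC) (hOSC : S.GDIOSC)
    (Fn : ℕ → V → NonemptyCompacts (VertexSpace d)) (F : V → NonemptyCompacts (VertexSpace d))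
    (hFn : ∀ n, (Sn n).IsAttractor (Fn n)) (hF : S.IsAttractor F) :
    ((∀ i j, upperBoxDim (C i : Set (VertexSpace d)) = upperBoxDim (C j : Set (VertexSpace d))) →
      ∀ i, Tendsto (fun n => upperBoxDim (Fn n i : Set (VertexSpace d))) atTop
        (𝓝 (upperBoxDim (F i : Set (VertexSpace d))))) ∧
    ((∀ i j, dimH (C i : Set (VertexSpace d)) = dimH (C j : Set (VertexSpace d))) →
      ∀ i, Tendsto (fun n => dimH (Fn n i : Set (VertexSpace d))) atTop
        (𝓝 (dimH (F i : Set (VertexSpace d))))) := by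
  classical
  have := Fintype.ofFinite E
  -- In dimension 0 the ratios are not determined by the maps, but all attractors are the single
  -- point.
  rcases Nat.eq_zero_or_pos d with rfl | hd
  · have hconst : ∀ n i, (Fn n i : Set (VertexSpace 0)) = F i := fun n i => by
      rw [(Fn n i).nonempty.eq_univ, (F i).nonempty.eq_univ]
    simp only [hconst]
    exact ⟨fun _ _ => tendsto_const_nhds, fun _ _ => tendsto_const_nhds⟩
  have : NeZero d := ⟨hd.ne'⟩
  choose rn hrn using fun n => (hsim n).exists_hasRatios
  obtain ⟨r, hr, hlim⟩ := GDIFS.exists_hasRatios_of_tendsto hrn hconv hinj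
  refine ⟨fun hC i => ?_, fun hC i => ?_⟩
  -- Equality of the dimensions of the C v makes c < t at the vertex i valid at every vertex.
  · refine G.tendsto_of_dichotomy (ι := fun t : ℝ => (t : EReal))
      (c := upperBoxDim (C i : Set (VertexSpace d))) (fun a b ha hab => ?_)
      (fun t t' h => EReal.coe_lt_coe_iff.1 h) hr.pos hr.lt_one hlim
      ((F i).isCompact.upperBoxDim_mono (hF.condensation_subset i))
      (fun n => (Fn n i).isCompact.upperBoxDim_mono ((hFn n).condensation_subset i))
      (fun t ht hsub hc => hF.upperBoxDim_le hr ht.le hsub (fun v => (hC v i).trans_lt hc) i)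
      (fun n t ht hsub hc =>
        (hFn n).upperBoxDim_le (hrn n) ht.le hsub (fun v => (hC v i).trans_lt hc) i)
      (fun t ht hsup => (hF.hasCoverBound hG hr hOSC ht.le hsup i).le_upperBoxDim
        (F i).isCompact)
      (fun n t ht hsup => ((hFn n).hasCoverBound hG (hrn n) (hOSCn n) ht.le hsup i).le_upperBoxDim
        (Fn n i).isCompact)
    obtain ⟨t, h1, h2⟩ := EReal.lt_iff_exists_real_btwn.1 hab
    exact ⟨t, EReal.coe_pos.1 (((upperBoxDim_nonneg _).trans ha).trans_lt h1), h1, h2⟩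
  · refine G.tendsto_of_dichotomy (ι := ENNReal.ofReal)
      (c := dimH (C i : Set (VertexSpace d))) (fun a b ha hab => ?_)
      (fun t t' h => (ENNReal.ofReal_lt_ofReal_iff'.1 h).1) hr.pos hr.lt_one hlim
      (dimH_mono (hF.condensation_subset i))
      (fun n => dimH_mono ((hFn n).condensation_subset i))
      (fun t ht hsub hc => hF.dimH_le hr ht hsub (fun v => (hC v i).trans_lt hc) i)
      (fun n t ht hsub hc =>
        (hFn n).dimH_le (hrn n) ht hsub (fun v => (hC v i).trans_lt hc) i)
      (fun t ht hsup => (hF.hasCoverBound hG hr hOSC ht.le hsup i).le_dimH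
        (F i).isCompact ht)
      (fun n t ht hsup => ((hFn n).hasCoverBound hG (hrn n) (hOSCn n) ht.le hsup i).le_dimH
        (Fn n i).isCompact ht)
    obtain ⟨t, -, h1, h2⟩ := ENNReal.lt_iff_exists_real_btwn.1 hab
    exact ⟨t, ENNReal.ofReal_pos.1 (zero_le.trans_lt h1), h1, h2⟩
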